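/- Let $S_n$ ($n\ge 0$) be the set of permutations $\pi=\pi_1\pi_2\cdots\pi_n$ of $\{1,\ldots,n\}$. Let $\mathrm{RSK}(\pi)=(S,T)$ be the pair of the insertion tableau and the recording tableau of $\pi$ under row insertion. Tableaux are drawn in French notation: rows are left-justified and numbered from bottom to top, and rows increase from left to right and columns from bottom to top. The reading word of a tableau is the word obtained by concatenating its rows from top to bottom, each read from left to right. Define $f:S_n\to S_n$ by letting $f(\pi)$ be the reading word of the recording tableau $T$ of $\pi$. For a partition $\lambda=(\lambda_1\ge\cdots\ge\lambda_k>0)$ of $n$, let $T_\lambda$ be the tableau of shape $\lambda$ obtained by filling the bottom boxes of the first $\lambda_k$ columns with $1,2,\ldots,\lambda_k$ from left to right, then filling the bottommost empty boxes of the first $\lambda_{k-1}$ columns with $\lambda_k+1,\ldots,\lambda_k+\lambda_{k-1}$ from left to right, and so on, ending with $\lambda_1$. Let $\pi\in S_n$ be a fixed point of $f$, that is, $f(\pi)=\pi$, and let $\lambda$ be the common shape of the two tableaux of $\mathrm{RSK}(\pi)$ (so that $\pi=\pi_\lambda$ is the fixed point of shape $\lambda$). Then $\pi$ is an involution, i.e.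 $\pi^{-1}=\pi$. Moreover, $\pi$ pairs the entries of each column of $T_\lambda$ with their vertically reflected entries: if a column of $T_\lambda$ has entries $c_1,c_2,\ldots,c_h$ from bottom to top, then $\pi(c_i)=c_{h+1-i}$ for all $1\le i\le h$. -/

import Mathlib

namespace RSKDyn

/-- A tableau is the list of its rows. Row `0` is the bottom (longest) row in French notation, and
each row is listed from left to right. -/
abbrev Tableau := List (List ℕ)

/-- Schensted insertion of `a` into one row. If `a` is smaller than no entry of the row, it is put
at the end; otherwise it replaces the leftmost entry greater than `a`, and that entry is returned
as the bumped one. -/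
def rowInsert (a : ℕ) : List ℕ → List ℕ × Option ℕ
  | [] => ([a], none)
  | b :: r =>
    if a < b then (a :: r, some b)
    else (b :: (rowInsert a r).1, (rowInsert a r).2)

/-- Row insertion of `a` into a tableau, starting in the bottom row; a bumped entry is inserted
into the next row. The second component is the index of the row at whose end the new box was
created. -/
def insert (a : ℕ) : Tableau → Tableau × ℕ
  | [] => ([[a]], 0)
  | r :: R =>
    match (rowInsert a r).2 with
    | none => ((rowInsert a r).1 :: R, 0)
    | some b => ((rowInsert a r).1 :: (insert b R).1, (insert b R).2 + 1)

/-- Add a box with label `m` at the end of row `k` of a tableau (if `k` is the number of rows, a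
new top row is created). -/
def addBox (m : ℕ) : ℕ → Tableau → Tableau
  | _, [] => [[m]]
  | 0, r :: R => (r ++ [m]) :: R
  | k + 1, r :: R => r :: addBox m k R

/-- Continue the RSK algorithm from the pair `(S, T)`: the letters of the given word are inserted
one after the other into `S`, and the boxes created are labelled `m, m + 1, …` in `T`. -/
def rskFrom (m : ℕ) (S T : Tableau) : List ℕ → Tableau × Tableau
  | [] => (S, T)
  | a :: w => rskFrom (m + 1) (insert a S).1 (addBox m (insert a S).2 T) w

/-- The pair (insertion tableau, recording tableau) of a word. -/
def rsk (w : List ℕ) : Tableau × Tableau := rskFrom 1 [] [] w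

/-- The reading word: the rows are concatenated from top to bottom. -/
def readingWord (T : Tableau) : List ℕ := T.reverse.flatten

/-- The shape of a tableau: the lengths `λ₁, λ₂, …` of its rows, from bottom to top. -/
def shape (T : Tableau) : List ℕ := T.map List.length

/-- The word `π₁, …, πₙ` of a permutation, with letters in `{1, …, n}`. The elements
`0, …, n - 1` of `Fin n` stand for `1, …, n`. -/
def oneLine {n : ℕ} (π : Equiv.Perm (Fin n)) : List ℕ := List.ofFn fun i => (π i : ℕ) + 1

theorem oneLine_length {n : ℕ} (π : Equiv.Perm (Fin n)) : (oneLine π).length = n := by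
  simp [oneLine]

theorem addBox_perm (m : ℕ) : ∀ (k : ℕ) (T : Tableau),
    (readingWord (addBox m k T)).Perm (m :: readingWord T)
  | _, [] => by simp [addBox, readingWord]
  | 0, r :: R => by
    simp only [addBox, readingWord, List.reverse_cons, List.flatten_append, List.flatten_cons,
      List.flatten_nil, List.append_nil, ← List.append_assoc]
    exact List.perm_append_comm
  | k + 1, r :: R => by
    have h := addBox_perm m k R
    simp only [addBox, readingWord, List.reverse_cons, List.flatten_append, List.flatten_cons,
      List.flatten_nil, List.append_nil] at h ⊢
    exact h.append_right r

theorem rskFrom_perm : ∀ (w : List ℕ) (m : ℕ) (S T : Tableau),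
    (readingWord (rskFrom m S T w).2).Perm (readingWord T ++ List.range' m w.length)
  | [], m, S, T => by simp [rskFrom]
  | a :: w, m, S, T => by
    refine (rskFrom_perm w (m + 1) _ _).trans ?_
    refine ((addBox_perm m _ T).append_right _).trans ?_
    rw [List.length_cons, List.range'_succ]
    exact List.perm_middle.symm

/-- The reading word of the recording tableau is a permutation of `1, …, n`. -/
theorem readingWord_rsk_perm {n : ℕ} (π : Equiv.Perm (Fin n)) :
    (readingWord (rsk (oneLine π)).2).Perm (List.range' 1 n) := by
  have h := rskFrom_perm (oneLine π) 1 [] []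
  rw [oneLine_length] at h
  exact h

/-- The permutation with a given word. -/
noncomputable def ofWord {n : ℕ} (w : List ℕ) (hw : w.Perm (List.range' 1 n)) :
    Equiv.Perm (Fin n) :=
  have hlen : w.length = n := by simpa using hw.length_eq
  have hmem : ∀ a ∈ w, 1 ≤ a ∧ a < 1 + n := fun a ha => List.mem_range'_1.1 (hw.mem_iff.1 ha)
  Equiv.ofBijective
    (fun i : Fin n => ⟨w[(i : ℕ)]'(by omega) - 1, by
      have := hmem _ (List.getElem_mem (l := w) (n := (i : ℕ)) (by omega)); omega⟩)
    (Finite.injective_iff_bijective.1 (by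
      intro i j hij
      have hi := hmem _ (List.getElem_mem (l := w) (n := (i : ℕ)) (by omega))
      have hj := hmem _ (List.getElem_mem (l := w) (n := (j : ℕ)) (by omega))
      have hnd : w.Nodup := hw.nodup_iff.2 List.nodup_range'
      have h := Fin.mk.inj_iff.1 hij
      exact Fin.ext ((hnd.getElem_inj_iff).1 (by omega))))

theorem oneLine_ofWord {n : ℕ} (w : List ℕ) (hw : w.Perm (List.range' 1 n)) :
    oneLine (ofWord w hw) = w := by
  have hlen : w.length = n := by simpa using hw.length_eq
  refine List.ext_getElem (by rw [oneLine_length, hlen]) fun i h1 h2 => ?_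
  have := List.mem_range'_1.1 (hw.mem_iff.1 (List.getElem_mem h2))
  simp only [oneLine, List.getElem_ofFn, ofWord, Equiv.ofBijective_apply]
  omega

/-- The map `f : Sₙ → Sₙ`: apply RSK and take the reading word of the recording tableau. -/
noncomputable def f {n : ℕ} (π : Equiv.Perm (Fin n)) : Equiv.Perm (Fin n) :=
  ofWord (readingWord (rsk (oneLine π)).2) (readingWord_rsk_perm π)

theorem oneLine_f {n : ℕ} (π : Equiv.Perm (Fin n)) :
    oneLine (f π) = readingWord (rsk (oneLine π)).2 :=
  oneLine_ofWord _ _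

/-- Column `j` (counted from `0`), listed from bottom to top, of the tableau `T_λ` of shape
`λ = (λ₁, …, λₖ)`: first the bottom boxes of the first `λₖ` columns are filled with
`1, …, λₖ` from left to right, then the lowest empty boxes of the first `λₖ₋₁` columns with
`λₖ + 1, …, λₖ + λₖ₋₁`, and so on down to `λ₁`. -/
def tColumn : List ℕ → ℕ → List ℕ
  | [], _ => []
  | p :: ps, j => if j < p then tColumn ps j ++ [ps.sum + j + 1] else tColumn ps j

/-- The value `π_a` of a permutation of `{1, …, n}` at a label `a` (and `0`, which is not a label,
if `a` is not in `{1, …, n}`). -/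
def atLabel {n : ℕ} (π : Equiv.Perm (Fin n)) (a : ℕ) : ℕ :=
  if h : 1 ≤ a ∧ a ≤ n then (π ⟨a - 1, by omega⟩ : ℕ) + 1 else 0

end RSKDyn

/-!
Semistandard tableaux suffice for the whole argument. When the reading word of a semistandard
tableau `T` is inserted, the letters of each row push the rows above it up by one step, column by
column: the letter in column `j` bumps the whole column `j`, so that the new box is the lowest empty
box of that column (`rskFrom_row`, `rskFrom_column`). Hence the recording tableau of the reading
word of `T` depends only on the shape of `T`, and is `T_λ` (`rsk_readingWord`).

The recording tableau `T` of any word is semistandard (`isSemistandard_rskFrom`). If `π` is a fixed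
point, the word of `π` is the reading word of its own recording tableau `T`, so `T = T_λ`. On the
other hand, the entry of `T_λ` created by the letter in row `i` and column `j` is the position of
that letter in the reading word. The `i`-th row from the bottom that meets column `j` creates the
`i`-th box from the top of that column of `T_λ`, so reading the letters of `π` at the positions
listed in a column of `T_λ` gives the same column of `T`, reversed (`map_tColumn`). Since `T = T_λ`,
`π` reverses each column of `T_λ`, and it is an involution because the columns contain all labels.
-/

namespace RSKDyn

/-! ### Semistandard tableaux -/

/-- `Below r R`: the row `R` may stand directly above the row `r`, that is, `R` is not longer than
`r` and each entry of `R` is greater than the entry of `r` under it. -/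
def Below : List ℕ → List ℕ → Prop
  | _, [] => True
  | [], _ :: _ => False
  | a :: r, b :: R => a < b ∧ Below r R

/-- Semistandard tableaux: the rows are nonempty and weakly increasing, their lengths weakly
decrease from bottom to top, and the columns are strictly increasing from bottom to top. -/
def IsSemistandard : Tableau → Prop
  | [] => True
  | r :: R => r ≠ [] ∧ r.Pairwise (· ≤ ·) ∧ Below r (R.headD []) ∧ IsSemistandard R

/-- Column `j` of a tableau, from bottom to top. -/
def column (j : ℕ) (T : Tableau) : List ℕ := T.filterMap (·[j]?)

theorem below_nil (r : List ℕ) : Below r [] := by cases r <;> trivial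

theorem Below.length_le : ∀ {r R : List ℕ}, Below r R → R.length ≤ r.length
  | _, [], _ => Nat.zero_le _
  | [], _ :: _, h => h.elim
  | _ :: _, _ :: _, h => Nat.succ_le_succ h.2.length_le

theorem Below.append_left : ∀ {r R : List ℕ} (s : List ℕ), Below r R → Below (r ++ s) R
  | _, [], _, _ => below_nil _
  | [], _ :: _, _, h => h.elim
  | _ :: _, _ :: _, s, h => ⟨h.1, h.2.append_left s⟩

theorem Below.append_singleton : ∀ {r R : List ℕ} {m : ℕ}, Below r R → (∀ x ∈ r, x < m) →
    R.length < r.length → Below r (R ++ [m])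
  | [], _, _, _, _, hl => absurd hl (Nat.not_lt_zero _)
  | a :: r, [], m, _, hm, _ => ⟨hm a (by simp), below_nil r⟩
  | a :: r, b :: R, m, h, hm, hl =>
    ⟨h.1, h.2.append_singleton (fun x hx => hm x (by simp [hx])) (by simpa using hl)⟩

/-! ### Insertion preserves semistandard tableaux -/

theorem mem_of_mem_rowInsert {a x : ℕ} : ∀ {r : List ℕ}, x ∈ (rowInsert a r).1 → x = a ∨ x ∈ r
  | [], h => by simpa [rowInsert] using h
  | b :: r, h => by
    rw [rowInsert] at h
    split_ifs at h
    · simp only [List.mem_cons] at h ⊢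
      tauto
    · have := mem_of_mem_rowInsert (a := a) (x := x) (r := r)
      simp only [List.mem_cons] at h ⊢
      tauto

theorem rowInsert_ne_nil (a : ℕ) (r : List ℕ) : (rowInsert a r).1 ≠ [] := by
  cases r with
  | nil => simp [rowInsert]
  | cons b r => rw [rowInsert]; split_ifs <;> simp

theorem pairwise_rowInsert (a : ℕ) : ∀ {r : List ℕ}, r.Pairwise (· ≤ ·) →
    (rowInsert a r).1.Pairwise (· ≤ ·)
  | [], _ => by simp [rowInsert]
  | b :: r, h => by
    rw [List.pairwise_cons] at h
    rw [rowInsert]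
    split_ifs with hab
    · exact List.pairwise_cons.2 ⟨fun x hx => hab.le.trans (h.1 x hx), h.2⟩
    · refine List.pairwise_cons.2 ⟨fun x hx => ?_, pairwise_rowInsert a h.2⟩
      rcases mem_of_mem_rowInsert hx with rfl | hx
      · omega
      · exact h.1 x hx

theorem lt_of_rowInsert_eq_some {a b : ℕ} : ∀ {r : List ℕ}, (rowInsert a r).2 = some b → a < b
  | [], h => by simp [rowInsert] at h
  | c :: r, h => by
    rw [rowInsert] at h
    split_ifs at h with hac
    · simp only [Option.some.injEq] at h
      omega
    · exact lt_of_rowInsert_eq_some (r := r) h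

theorem length_rowInsert (a : ℕ) : ∀ r : List ℕ,
    (rowInsert a r).1.length = if (rowInsert a r).2 = none then r.length + 1 else r.length
  | [] => by simp [rowInsert]
  | c :: r => by
    have := length_rowInsert a r
    rw [rowInsert]
    by_cases hac : a < c
    · simp [hac]
    · simp only [if_neg hac, List.length_cons, this]
      split_ifs <;> rfl

theorem Below.rowInsert_left (a : ℕ) : ∀ {r R : List ℕ}, Below r R → Below (rowInsert a r).1 R
  | _, [], _ => below_nil _
  | [], _ :: _, h => h.elim
  | c :: r, d :: R, h => by
    rw [rowInsert]
    split_ifs with hac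
    · exact ⟨hac.trans h.1, h.2⟩
    · exact ⟨h.1, h.2.rowInsert_left a⟩

/-- The bumped entry moves weakly to the left when it passes to the next row, so the two rows still
fit on top of each other. -/
theorem Below.rowInsert {a b : ℕ} : ∀ {r R : List ℕ}, Below r R → (rowInsert a r).2 = some b →
    Below (rowInsert a r).1 (rowInsert b R).1
  | [], _, _, hb => by simp [RSKDyn.rowInsert] at hb
  | c :: r, R, h, hb => by
    rw [RSKDyn.rowInsert] at hb ⊢
    split_ifs at hb ⊢ with hac
    · obtain rfl : c = b := by simpa using hb
      cases R with
      | nil => exact ⟨hac, below_nil _⟩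
      | cons d R =>
        rw [RSKDyn.rowInsert, if_pos h.1]
        exact ⟨hac, h.2⟩
    · have hab : a < b := lt_of_rowInsert_eq_some (r := r) hb
      cases R with
      | nil => exact ⟨by omega, below_nil _⟩
      | cons d R =>
        rw [RSKDyn.rowInsert]
        split_ifs with hbd
        · exact ⟨by omega, h.2.rowInsert_left a⟩
        · exact ⟨h.1, h.2.rowInsert hb⟩

theorem headD_insert (a : ℕ) (S : Tableau) :
    (insert a S).1.headD [] = (rowInsert a (S.headD [])).1 := by
  cases S with
  | nil => simp [insert, rowInsert]
  | cons r R =>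
    rw [insert]
    split <;> rfl

theorem IsSemistandard.insert : ∀ {S : Tableau} (a : ℕ), IsSemistandard S →
    IsSemistandard (insert a S).1
  | [], a, _ => ⟨by simp, by simp, below_nil _, trivial⟩
  | r :: R, a, h => by
    obtain ⟨-, hs, hb, hR⟩ := h
    rw [RSKDyn.insert]
    split
    · exact ⟨rowInsert_ne_nil a r, pairwise_rowInsert a hs, hb.rowInsert_left a, hR⟩
    · rename_i b hab
      exact ⟨rowInsert_ne_nil a r, pairwise_rowInsert a hs,
        by rw [headD_insert]; exact hb.rowInsert hab, hR.insert b⟩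

/-! ### The recording tableau is semistandard -/

theorem shape_insert (m : ℕ) : ∀ (a : ℕ) {S T : Tableau}, shape S = shape T →
    shape (insert a S).1 = shape (addBox m (insert a S).2 T)
  | a, [], [], _ => rfl
  | _, [], _ :: _, h => by simp [shape] at h
  | _, _ :: _, [], h => by simp [shape] at h
  | a, r :: R, t :: T, h => by
    simp only [shape, List.map_cons, List.cons.injEq] at h
    have hl := length_rowInsert a r
    rw [insert]
    split
    · rename_i hn
      simp [hn] at hl
      simp [shape, addBox, hl, h.1, h.2]
    · rename_i b hb
      simp [hb] at hl
      have := shape_insert m b (S := R) (T := T) h.2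
      simp only [shape] at this
      simp [shape, addBox, hl, h.1, this]

theorem mem_addBox {m x : ℕ} {k : ℕ} {T : Tableau} (h : x ∈ readingWord (addBox m k T)) :
    x = m ∨ x ∈ readingWord T := by
  simpa using (addBox_perm m k T).mem_iff.1 h

theorem readingWord_cons (r : List ℕ) (R : Tableau) :
    readingWord (r :: R) = readingWord R ++ r := by
  simp [readingWord]

/-- A label greater than all entries may be added wherever the resulting shape is that of a
semistandard tableau `S`. -/
theorem IsSemistandard.addBox {m : ℕ} : ∀ {k : ℕ} {S T : Tableau}, IsSemistandard T →
    (∀ x ∈ readingWord T, x < m) → IsSemistandard S → shape S = shape (addBox m k T) →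
    IsSemistandard (addBox m k T)
  | k, _, [], _, _, _, _ => by
    cases k <;> exact ⟨by simp, by simp, below_nil _, trivial⟩
  | 0, _, t :: T, ht, hm, _, _ => by
    obtain ⟨-, hs, hb, hT⟩ := ht
    refine ⟨by simp, ?_, hb.append_left _, hT⟩
    refine List.pairwise_append.2 ⟨hs, by simp, fun x hx y hy => ?_⟩
    have := hm x (by simp [readingWord_cons, hx])
    rw [List.mem_singleton.1 hy]
    exact this.le
  | k + 1, [], t :: T, _, _, _, h => by simp [shape, RSKDyn.addBox] at h
  | k + 1, s :: S, t :: T, ht, hm, hS, h => by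
    obtain ⟨hne, hs, hb, hT⟩ := ht
    obtain ⟨-, -, hbS, hSS⟩ := hS
    simp only [shape, RSKDyn.addBox, List.map_cons, List.cons.injEq] at h
    have hm' : ∀ x ∈ t, x < m := fun x hx => hm x (by simp [readingWord_cons, hx])
    refine ⟨hne, hs, ?_, hT.addBox (fun x hx => hm x (by simp [readingWord_cons, hx])) hSS h.2⟩
    have hlen : (S.headD []).length = ((RSKDyn.addBox m k T).headD []).length := by
      have h2 := congrArg (fun l => l.headD 0) h.2
      cases S <;> cases hA : RSKDyn.addBox m k T <;> simp_all
    have hle := hbS.length_le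
    rw [hlen, h.1] at hle
    match k, T with
    | k, [] =>
      cases k <;> exact Below.append_singleton (R := []) (below_nil _) hm'
        (by simpa [RSKDyn.addBox, Nat.succ_le_iff] using hle)
    | 0, u :: T =>
      exact Below.append_singleton hb hm' (by simpa [RSKDyn.addBox] using hle)
    | k + 1, u :: T => exact hb

theorem isSemistandard_rskFrom : ∀ (w : List ℕ) {m : ℕ} {S T : Tableau}, IsSemistandard S →
    IsSemistandard T → shape S = shape T → (∀ x ∈ readingWord T, x < m) →
    IsSemistandard (rskFrom m S T w).2
  | [], _, _, _, _, hT, _, _ => hT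
  | a :: w, m, S, T, hS, hT, h, hm => by
    have hsh := shape_insert m a h
    refine isSemistandard_rskFrom w (hS.insert a) (hT.addBox hm (hS.insert a) hsh) hsh
      fun x hx => ?_
    rcases mem_addBox hx with rfl | hx
    · omega
    · exact (hm x hx).trans (Nat.lt_succ_self m)

/-! ### Inserting the reading word of a semistandard tableau -/

theorem rowInsert_append_cons {a b : ℕ} (hab : a < b) (r : List ℕ) : ∀ {u : List ℕ},
    (∀ x ∈ u, x ≤ a) → rowInsert a (u ++ b :: r) = (u ++ a :: r, some b)
  | [], _ => by simp [rowInsert, hab]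
  | c :: u, hu => by
    have hc : ¬ a < c := by have := hu c (by simp); omega
    have := rowInsert_append_cons hab r (u := u) fun x hx => hu x (by simp [hx])
    simp [rowInsert, hc, this]

theorem rowInsert_of_forall_le {a : ℕ} : ∀ {u : List ℕ}, (∀ x ∈ u, x ≤ a) →
    rowInsert a u = (u ++ [a], none)
  | [], _ => rfl
  | c :: u, hu => by
    have hc : ¬ a < c := by have := hu c (by simp); omega
    have := rowInsert_of_forall_le (u := u) fun x hx => hu x (by simp [hx])
    simp [rowInsert, hc, this]

/-- Inserting a weakly increasing word `w` into a tableau whose bottom row is `r`, where `Below w r`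
holds, bumps the entries of `r` in order, so that the word `r` is inserted into the tableau formed
by the upper rows. The part `u` of the bottom row stands for the letters inserted before. -/
theorem rskFrom_row : ∀ (w : List ℕ) {u r t : List ℕ} {m : ℕ} {S Q : Tableau},
    (u ++ w).Pairwise (· ≤ ·) → Below w r →
    rskFrom m ((u ++ r) :: S) (t :: Q) w =
      ((u ++ w) :: (rskFrom m S Q r).1,
        (t ++ List.range' (m + r.length) (w.length - r.length)) :: (rskFrom m S Q r).2)
  | [], u, [], t, m, S, Q, _, _ => by simp [rskFrom]
  | [], _, _ :: _, _, _, _, _, _, h => h.elim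
  | a :: w, u, [], t, m, S, Q, hs, _ => by
    have hu : ∀ x ∈ u, x ≤ a := fun x hx => (List.pairwise_append.1 hs).2.2 x hx a (by simp)
    have ih := rskFrom_row w (u := u ++ [a]) (r := []) (t := t ++ [m]) (m := m + 1) (S := S)
      (Q := Q) (by simpa using hs) (below_nil w)
    simp only [List.append_nil] at ih
    simp [rskFrom, insert, rowInsert_of_forall_le hu, addBox, ih, List.range'_succ]
  | a :: w, u, b :: r, t, m, S, Q, hs, h => by
    have hu : ∀ x ∈ u, x ≤ a := fun x hx => (List.pairwise_append.1 hs).2.2 x hx a (by simp)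
    have ih := rskFrom_row w (u := u ++ [a]) (r := r) (t := t) (m := m + 1) (S := (insert b S).1)
      (Q := addBox m (insert b S).2 Q) (by simpa using hs) h.2
    simp only [List.append_assoc, List.singleton_append] at ih
    simp [rskFrom, insert, rowInsert_append_cons h.1 r hu, addBox, ih, Nat.add_assoc,
      Nat.add_comm 1]

theorem rskFrom_nil_nil {a : ℕ} {w : List ℕ} (hs : (a :: w).Pairwise (· ≤ ·)) (m : ℕ) :
    rskFrom m [] [] (a :: w) = ([a :: w], [List.range' m (w.length + 1)]) := by
  have := rskFrom_row w (u := [a]) (r := []) (t := [m]) (m := m + 1) (S := []) (Q := []) hs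
    (below_nil w)
  simpa [rskFrom, insert, addBox, List.range'_succ] using this

theorem column_eq_nil {j : ℕ} : ∀ {S Q : Tableau}, IsSemistandard S → shape S = shape Q →
    (S.headD []).length ≤ j → column j Q = []
  | [], [], _, _, _ => rfl
  | [], _ :: _, _, h, _ => by simp [shape] at h
  | _ :: _, [], _, _, _ => rfl
  | s :: S, q :: Q, hS, h, hj => by
    simp only [shape, List.map_cons, List.cons.injEq] at h
    have ih := column_eq_nil (j := j) (Q := Q) hS.2.2.2 h.2 (hS.2.2.1.length_le.trans hj)
    have hq : q[j]? = none := List.getElem?_eq_none (h.1 ▸ hj)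
    simpa [column, hq] using ih

/-- Inserting the letters of the bottom row `r` of a semistandard tableau into the tableau of the
other rows restores the whole tableau, and the letter in column `j` creates a box on top of
column `j`. -/
theorem rskFrom_column : ∀ {r : List ℕ} {S Q : Tableau} (m : ℕ), IsSemistandard (r :: S) →
    shape S = shape Q →
    (rskFrom m S Q r).1 = r :: S ∧ shape (rskFrom m S Q r).2 = shape (r :: S) ∧
      ∀ j, column j (rskFrom m S Q r).2 = column j Q ++ if j < r.length then [m + j] else []
  | _, [], _ :: _, _, _, h => by simp [shape] at h
  | _, _ :: _, [], _, _, h => by simp [shape] at h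
  | [], [], [], _, hS, _ => absurd rfl hS.1
  | a :: w, [], [], m, hS, _ => by
    rw [rskFrom_nil_nil hS.2.1]
    refine ⟨rfl, by simp [shape], fun j => ?_⟩
    by_cases hj : j < w.length + 1
    · simp [column, hj]
    · simp [column, hj]
  | r, s :: S, q :: Q, m, hS, h => by
    obtain ⟨-, hs, hb, hSS⟩ := hS
    have hle : s.length ≤ r.length := hb.length_le
    have hrow := rskFrom_row r (u := []) (t := q) (m := m) (S := S) (Q := Q) hs hb
    simp only [List.nil_append, List.headD_cons] at hrow
    have h' := h
    simp only [shape, List.map_cons, List.cons.injEq] at h'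
    obtain ⟨ih1, ih2, ih3⟩ := rskFrom_column m hSS h'.2
    rw [hrow]
    refine ⟨by rw [ih1], ?_, fun j => ?_⟩
    · simp only [shape, List.map_cons] at ih2 ⊢
      rw [ih2, List.length_append, List.length_range', ← h'.1]
      simp only [List.cons.injEq, and_true]
      omega
    · have hcons : ∀ (l : List ℕ) (L : Tableau), column j (l :: L) = l[j]?.toList ++ column j L := by
        intro l L
        cases hl : l[j]? <;> simp [column, hl]
      rw [hcons, hcons, ih3]
      by_cases hj : j < s.length
      · rw [List.getElem?_append_left (h'.1 ▸ hj), if_pos hj, if_pos (by omega), List.append_assoc]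
      · rw [column_eq_nil (j := j) hSS.2.2.2 h'.2 (hSS.2.2.1.length_le.trans (by omega)),
          List.getElem?_append_right (by omega), if_neg hj,
          List.getElem?_eq_none (l := q) (by omega)]
        by_cases hj' : j < r.length
        · rw [List.getElem?_range' (by omega), if_pos hj']
          simp
          omega
        · rw [List.getElem?_eq_none (by simp; omega), if_neg hj']
          rfl

theorem rskFrom_append : ∀ (w v : List ℕ) (m : ℕ) (S T : Tableau),
    rskFrom m S T (w ++ v) =
      rskFrom (m + w.length) (rskFrom m S T w).1 (rskFrom m S T w).2 v
  | [], v, m, S, T => rfl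
  | a :: w, v, m, S, T => by
    simp only [List.cons_append, rskFrom, rskFrom_append w v, List.length_cons]
    rw [Nat.add_right_comm, Nat.add_assoc]

theorem length_readingWord (T : Tableau) : (readingWord T).length = (shape T).sum := by
  simp [readingWord, shape, List.length_flatten]

/-- The reading word of a semistandard tableau `T` has insertion tableau `T`, and its recording
tableau is `T_λ`, where `λ` is the shape of `T`. -/
theorem rsk_readingWord : ∀ {T : Tableau}, IsSemistandard T →
    (rsk (readingWord T)).1 = T ∧ shape (rsk (readingWord T)).2 = shape T ∧
      ∀ j, column j (rsk (readingWord T)).2 = tColumn (shape T) j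
  | [], _ => ⟨rfl, rfl, fun _ => rfl⟩
  | r :: R, h => by
    obtain ⟨ih1, ih2, ih3⟩ := rsk_readingWord h.2.2.2
    obtain ⟨h1, h2, h3⟩ := rskFrom_column (1 + (readingWord R).length) h ih2.symm
    rw [rsk, readingWord_cons, rskFrom_append]
    simp only [rsk] at ih1 ih2 ih3 h1 h2 h3
    rw [ih1]
    refine ⟨h1, h2, fun j => ?_⟩
    rw [h3, ih3, length_readingWord]
    simp only [shape, List.map_cons, tColumn]
    split_ifs
    · simp only [List.append_cancel_left_eq, List.cons.injEq, and_true]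
      omega
    · simp

/-! ### The columns of `T_λ` -/

theorem mem_tColumn_bounds {a j : ℕ} : ∀ {l : List ℕ}, a ∈ tColumn l j → 1 ≤ a ∧ a ≤ l.sum
  | [], h => by simp [tColumn] at h
  | p :: ps, h => by
    have ih := mem_tColumn_bounds (a := a) (j := j) (l := ps)
    rw [tColumn] at h
    rw [List.sum_cons]
    split_ifs at h with hj
    · rcases List.mem_append.1 h with h | h
      · have := ih h
        omega
      · rw [List.mem_singleton] at h
        omega
    · have := ih h
      omega

theorem exists_mem_tColumn {a : ℕ} (h1 : 1 ≤ a) : ∀ {l : List ℕ}, a ≤ l.sum → ∃ j, a ∈ tColumn l j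
  | [], h => by simp at h; omega
  | p :: ps, h => by
    rw [List.sum_cons] at h
    by_cases ha : a ≤ ps.sum
    · obtain ⟨j, hj⟩ := exists_mem_tColumn h1 ha
      refine ⟨j, ?_⟩
      rw [tColumn]
      split_ifs
      · exact List.mem_append_left _ hj
      · exact hj
    · refine ⟨a - ps.sum - 1, ?_⟩
      rw [tColumn, if_pos (by omega)]
      refine List.mem_append_right _ (List.mem_singleton.2 ?_)
      omega

/-- The labels in column `j` of `T_λ` are the positions in the reading word of the entries of
column `j` of a tableau of shape `λ`, listed from top to bottom. -/
theorem map_tColumn (j : ℕ) : ∀ T : Tableau,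
    (tColumn (shape T) j).map (fun a => (readingWord T).getD (a - 1) 0) = (column j T).reverse
  | [] => rfl
  | r :: R => by
    have hR : (tColumn (shape R) j).map (fun a => (readingWord (r :: R)).getD (a - 1) 0) =
        (column j R).reverse := by
      rw [← map_tColumn j R]
      refine List.map_congr_left fun a ha => ?_
      have := mem_tColumn_bounds ha
      rw [readingWord_cons, List.getD_append _ _ _ _ (by rw [length_readingWord]; omega)]
    have hsum : (List.map List.length R).sum = (readingWord R).length :=
      (length_readingWord R).symm
    simp only [shape, List.map_cons, tColumn] at hR ⊢
    split_ifs with hj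
    · rw [List.map_append, hR]
      simp [column, hj, readingWord_cons, hsum]
    · rw [hR]
      simp [column, hj]

theorem atLabel_eq_getD {n : ℕ} (π : Equiv.Perm (Fin n)) {a : ℕ} (h1 : 1 ≤ a) (h2 : a ≤ n) :
    atLabel π a = (oneLine π).getD (a - 1) 0 := by
  have : a - 1 < n := by omega
  simp [atLabel, oneLine, h1, h2, this]

end RSKDyn

open RSKDyn in
theorem mainTheorem8 (n : ℕ) (π : Equiv.Perm (Fin n)) (hπ : RSKDyn.f π = π)
    (lam : List ℕ) (hlam : lam = RSKDyn.shape (RSKDyn.rsk (RSKDyn.oneLine π)).2) :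
    π⁻¹ = π ∧
      ∀ j : ℕ, (RSKDyn.tColumn lam j).map (RSKDyn.atLabel π) = (RSKDyn.tColumn lam j).reverse := by
  have hT : IsSemistandard (rsk (oneLine π)).2 :=
    isSemistandard_rskFrom (oneLine π) trivial trivial rfl (by simp [readingWord])
  have hw : readingWord (rsk (oneLine π)).2 = oneLine π := by rw [← oneLine_f, hπ]
  have hcol := (rsk_readingWord hT).2.2
  rw [hw, ← hlam] at hcol
  have hsum : lam.sum = n := by rw [hlam, ← length_readingWord, hw, oneLine_length]
  have hrev : ∀ j, (tColumn lam j).map (atLabel π) = (tColumn lam j).reverse := by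
    intro j
    have hmap := map_tColumn j (rsk (oneLine π)).2
    rw [hw, ← hlam, hcol] at hmap
    rw [← hmap]
    refine List.map_congr_left fun a ha => ?_
    have := mem_tColumn_bounds ha
    exact atLabel_eq_getD π this.1 (hsum ▸ this.2)
  refine ⟨?_, hrev⟩
  have hinv : ∀ a, 1 ≤ a → a ≤ n → atLabel π (atLabel π a) = a := by
    intro a h1 h2
    obtain ⟨j, hj⟩ := exists_mem_tColumn h1 (hsum.symm ▸ h2 : a ≤ lam.sum)
    have h : ((tColumn lam j).map (atLabel π)).map (atLabel π) = tColumn lam j := by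
      rw [hrev, List.map_reverse, hrev, List.reverse_reverse]
    rw [List.map_map] at h
    exact List.map_inj_left.1 (h.trans (List.map_id _).symm) a hj
  refine inv_eq_of_mul_eq_one_left (Equiv.ext fun i => Fin.ext ?_)
  have h := hinv (i + 1) (by omega) (by omega)
  have hi : atLabel π (i + 1) = (π i : ℕ) + 1 := by simp [atLabel]
  have hi' : atLabel π ((π i : ℕ) + 1) = (π (π i) : ℕ) + 1 := by simp [atLabel]
  rw [hi, hi'] at h
  simpa using h
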